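/- **Setting.** A *timetable* has finitely many stations, each with a minimum transfer time $\mathrm{transfer}(S)\in\mathbb N$, and finitely many elementary connections $c=(Z_1,Z_2,S_1,S_2,t_d,t_a)$: a train leaves $S_1$ after stop event $Z_1$ at time of day $t_d$, and its next stop is $Z_2$ at $S_2$ at time of day $t_a$ ($t_d,t_a\in\{0,\dots,1439\}$). Each $c$ has a set of days (out of $N$ traffic days) on which it departs; $\mathrm{length}(c)=(t_a-t_d)\bmod 1440$. At most one elementary connection departs from, and at most one arrives with, a given stop event of a station. A *consistent connection* from $A$ to $B$ is a nonempty sequence of elementary connections $c_i$ with absolute departure times $\mathrm{dep}_i$ such that $S_1(c_1)=A$, $S_2(c_k)=B$, $c_i$ is valid on day $\lfloor \mathrm{dep}_i/1440\rfloor$, $\mathrm{dep}_i\equiv t_d(c_i) \pmod{1440}$, $\mathrm{arr}_i=\mathrm{dep}_i+\mathrm{length}(c_i)$, $S_2(c_i)=S_1(c_{i+1})$, and $\mathrm{dep}_{i+1}-\mathrm{arr}_i\ge 0$ if $Z_1(c_{i+1})=Z_2(c_i)$, $\ge \mathrm{transfer}(S_2(c_i))$ otherwise. The *earliest arrival problem*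 (EAP) for a time query $(A,B,t_0)$ asks for the minimal arrival time of a consistent connection from $A$ to $B$ departing not before $t_0$ ($\bot$ if there is none; $t_0$ if $A=B$). **Station graph.** A station graph has one node per station and to each ordered pair of stations (edge, possibly a loop) a set of connections, each stored as $(Z_1,Z_2,\mathrm{dep},\mathrm{arr})$; the edge exists if the set is nonempty. Initially an edge $(u,w)$ holds all rides of a single elementary connection from $u$ to $w$. Two connections are *linked* if they are consistent one after the other. Let $\mathrm{parr}(Q)$ be the previous arrival time of the train of $Z_1(Q)$ at $S_1(Q)$ and $\mathrm{ndep}(Q)$ the next departure time of the train of $Z_2(Q)$ at $S_2(Q)$ (if they exist); the departure of $Q$ is *critical* if $\mathrm{dep}(Q)-\mathrm{parr}(Q)<\mathrm{transfer}(S_1(Q))$, its arrival if $\mathrm{ndep}(Q)-\mathrm{arr}(Q)<\mathrm{transfer}(S_2(Q))$. $P$ *dominates* $Q$ if they have the same end points; $\mathrm{dep}(Q)\le\mathrm{dep}(P)$, $\mathrm{arr}(P)\le\mathrm{arr}(Q)$; $Z_1(Q)=Z_1(P)$ or the departure of $Q$ is not critical or $\mathrm{dep}(P)-\mathrm{parr}(Q)\ge\mathrm{transfer}(S_1(P))$;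 and $Z_2(Q)=Z_2(P)$ or the arrival of $Q$ is not critical or $\mathrm{ndep}(Q)-\mathrm{arr}(P)\ge\mathrm{transfer}(S_2(P))$. **Contraction.** Contracting $v$ removes $v$ with its edges. For remaining $u,w$ (possibly $u=w$, giving a loop) the shortcut $(u,w)$ represents all connections obtained by linking along $\langle u,v,w\rangle$ and, if $v$ has a loop, along $\langle u,v,v,w\rangle,\langle u,v,v,v,w\rangle,\dots$. The new edge $(u,w)$ holds connections of the old edge $(u,w)$ and of the shortcut (parallel edges are merged) such that every connection of the old edge is dominated by one of the new edge, and every connection of the shortcut is dominated by one of the new edge or by a witness, i.e. a connection along a path from $u$ to $w$ in the graph before the contraction that avoids $v$. A *station graph CH* results from contracting all stations in any order, with any such choices; its edge $(u,w)$ is the edge $(u,w)$ just before the first of $u,w$ is contracted. **Time query $(A,B,t_0)$ in the CH.** First, a backward breadth-first search from $B$ over the edges $(S,T)$ with $T$ contracted before $S$ marks all such edges into visited nodes. Then a label correcting forward search from $A$ keeps at each station a set of arrival connections $(\mathrm{arr},Z_2)$. It starts with $(t_0,\forall)$ at $A$, where the special stop event $\forall$ allows boarding every train departing at or after $t_0$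 and $A$ is in the priority queue with key $t_0$. Repeatedly it removes a station $S$ with minimal key $t$ and returns $t$ if $S=B$. Otherwise it relaxes all edges $(S,T)$ that are loops, lead to a $T$ contracted after $S$, or are marked: the arrival connections at $S$ are linked with the edge and merged with those at $T$ to a dominant set (one representative per class of equivalent ones, an old one if available; domination of arrival connections compares only the arrival side, and $\forall$ dominates all later arrivals and is dominated by no other); if the set at $T$ changes, $T$ is put into the queue with its minimal arrival time as key. If the queue is empty, $\bot$ is returned. **Theorem.** For every timetable, every station graph CH of it and every time query $(A,B,t_0)$, every execution of the time query in the CH terminates and returns the solution of the EAP. -/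

import Mathlib

namespace StationGraph

/-! ### Timetables and consistent connections -/

/-- An elementary connection `(Z₁, Z₂, S₁, S₂, t_d, t_a)`: a train leaves station `S1` at time `td`
after its stop `Z1`, and its immediately next stop is `Z2` at station `S2`, at time `ta`. Labels of
stop events are local to a station (they are only ever compared at one and the same station). -/
structure ElemConn (B Z : Type*) where
  Z1 : Z
  Z2 : Z
  S1 : B
  S2 : B
  td : ℤ
  ta : ℤ

/-- The smallest nonnegative integer congruent to `t' - t` modulo `1440`. -/
def cycleDiff (t t' : ℤ) : ℤ := (t' - t) % 1440

/-- `length(c)`. -/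
def ElemConn.length {B Z : Type*} (c : ElemConn B Z) : ℤ := cycleDiff c.td c.ta

/-- A timetable. Times of day are in minutes after midnight, `transfer S` is the minimum transfer
time of the station `S`, `days c` is the set of those of the `N` traffic days on which `c` departs
(for trains that operate daily, all of them). A stop event is a single stop of a single train, so at
most one elementary connection departs from it and at most one arrives with it. -/
structure Timetable (B Z : Type*) where
  conns : Finset (ElemConn B Z)
  transfer : B → ℕ
  N : ℕ
  days : ElemConn B Z → Finset ℤ
  td_mem : ∀ c ∈ conns, 0 ≤ c.td ∧ c.td ≤ 1439
  ta_mem : ∀ c ∈ conns, 0 ≤ c.ta ∧ c.ta ≤ 1439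
  days_mem : ∀ c ∈ conns, ∀ d ∈ days c, 0 ≤ d ∧ d < N
  dep_unique : ∀ c ∈ conns, ∀ c' ∈ conns, c.S1 = c'.S1 → c.Z1 = c'.Z1 → c = c'
  arr_unique : ∀ c ∈ conns, ∀ c' ∈ conns, c.S2 = c'.S2 → c.Z2 = c'.Z2 → c = c'

variable {B Z : Type*}

namespace Timetable

open Classical in
/-- The time needed at station `S` between arriving with stop event `z` and departing with stop
event `z'`: nothing for staying on the train, the minimum transfer time otherwise. -/
noncomputable def minWait (T : Timetable B Z) (S : B) (z z' : Z) : ℤ :=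
  if z' = z then 0 else (T.transfer S : ℤ)

/-- `c` can be ridden with departure at the absolute time `d` (in minutes from the beginning of the
first day): it is valid on the day of `d`, and departs at that time of the day. -/
def Runs (T : Timetable B Z) (x : ElemConn B Z × ℤ) : Prop :=
  x.1 ∈ T.conns ∧ x.2 / 1440 ∈ T.days x.1 ∧ x.2 ≡ x.1.td [ZMOD 1440]

/-- Riding `x.1` from time `x.2` may be followed by riding `y.1` from time `y.2`. -/
def Follows (T : Timetable B Z) (x y : ElemConn B Z × ℤ) : Prop :=
  x.1.S2 = y.1.S1 ∧ T.minWait x.1.S2 x.1.Z2 y.1.Z1 ≤ y.2 - (x.1.length + x.2)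

/-- `P = ((c₁, dep₁), …, (c_k, dep_k))` with `arr_i = length(c_i) + dep_i` is a consistent connection
from station `a` to station `b` with departure time `d` and arrival time `t`. -/
def IsConsistent (T : Timetable B Z) (P : List (ElemConn B Z × ℤ)) (a b : B) (d t : ℤ) : Prop :=
  (∀ x ∈ P, T.Runs x) ∧ P.IsChain T.Follows ∧
    (∃ x, P.head? = some x ∧ x.1.S1 = a ∧ x.2 = d) ∧
    (∃ x, P.getLast? = some x ∧ x.1.S2 = b ∧ x.1.length + x.2 = t)

/-- With the time query `(a, b, t₀)` one can be at `b` at time `t`: some valid consistent connection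
(departing not before `t₀`) arrives at `b` at time `t`, or `b = a` and `t = t₀`. -/
def Reaches (T : Timetable B Z) (a b : B) (t₀ t : ℤ) : Prop :=
  (b = a ∧ t = t₀) ∨ ∃ P d, T.IsConsistent P a b d t ∧ t₀ ≤ d

/-- The answer `r` solves the earliest arrival problem for the time query `(a, b, t₀)`: it is the
minimal arrival time, or `none` (that is, `⊥`) if `b` cannot be reached. -/
def SolvesEAP (T : Timetable B Z) (a b : B) (t₀ : ℤ) : Option ℤ → Prop
  | some t => IsLeast {t' | T.Reaches a b t₀ t'} t
  | none => ∀ t, ¬ T.Reaches a b t₀ t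

end Timetable

/-! ### The station graph, linking and domination -/

/-- A connection as it is stored with an edge: first and last stop event, departure and arrival
station, departure and arrival time (including days). -/
structure Conn (B Z : Type*) where
  Z1 : Z
  Z2 : Z
  S1 : B
  S2 : B
  dep : ℤ
  arr : ℤ

/-- A station graph: one node per station, and for each ordered pair of stations one set of
connections. There is an edge `(u, w)` iff the set for `u`, `w` is nonempty. -/
abbrev Graph (B Z : Type*) := B → B → Set (Conn B Z)

/-- The connection obtained by linking `P` and `Q`. -/
def Conn.link (P Q : Conn B Z) : Conn B Z := ⟨P.Z1, Q.Z2, P.S1, Q.S2, P.dep, Q.arr⟩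

namespace Timetable

/-- The station graph of the timetable: the edge `(u, w)` holds all rides of a single elementary
connection from `u` to `w`. -/
def stationGraph (T : Timetable B Z) : Graph B Z := fun u w =>
  {P | ∃ c d, T.Runs (c, d) ∧ c.S1 = u ∧ c.S2 = w ∧ P = ⟨c.Z1, c.Z2, u, w, d, c.length + d⟩}

/-- `P` followed by `Q` is consistent. -/
def CanLink (T : Timetable B Z) (P Q : Conn B Z) : Prop :=
  P.S2 = Q.S1 ∧ T.minWait P.S2 P.Z2 Q.Z1 ≤ Q.dep - P.arr

/-- `parr = t`, for a departure at time `d` from the station `S` with the stop event `z`: the train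
of `z` has arrived there at time `t`. There is no such `t` if the train begins there. -/
def IsPrevArr (T : Timetable B Z) (S : B) (z : Z) (d t : ℤ) : Prop :=
  ∃ c ∈ T.conns, c.S2 = S ∧ c.Z2 = z ∧ t = d - cycleDiff c.ta d

/-- `ndep = t`, for an arrival at time `d` at the station `S` with the stop event `z`: the train of
`z` departs there at time `t`. There is no such `t` if the train ends there. -/
def IsNextDep (T : Timetable B Z) (S : B) (z : Z) (d t : ℤ) : Prop :=
  ∃ c ∈ T.conns, c.S1 = S ∧ c.Z1 = z ∧ t = d + cycleDiff d c.td

/-- A departure is critical if the residence time is less than the transfer time. -/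
def CriticalDep (T : Timetable B Z) (S : B) (z : Z) (d : ℤ) : Prop :=
  ∃ t, T.IsPrevArr S z d t ∧ d - t < T.transfer S

/-- An arrival is critical if the residence time is less than the transfer time. -/
def CriticalArr (T : Timetable B Z) (S : B) (z : Z) (d : ℤ) : Prop :=
  ∃ t, T.IsNextDep S z d t ∧ t - d < T.transfer S

/-- The connection `P` dominates the connection `Q`. -/
def Dominates (T : Timetable B Z) (P Q : Conn B Z) : Prop :=
  (P.S1 = Q.S1 ∧ P.S2 = Q.S2) ∧
  (Q.dep ≤ P.dep ∧ P.arr ≤ Q.arr) ∧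
  (Q.Z1 = P.Z1 ∨ ¬ T.CriticalDep Q.S1 Q.Z1 Q.dep ∨
    ∃ t, T.IsPrevArr Q.S1 Q.Z1 Q.dep t ∧ T.transfer P.S1 ≤ P.dep - t) ∧
  (Q.Z2 = P.Z2 ∨ ¬ T.CriticalArr Q.S2 Q.Z2 Q.arr ∨
    ∃ t, T.IsNextDep Q.S2 Q.Z2 Q.arr t ∧ T.transfer P.S2 ≤ t - P.arr)

end Timetable

/-! ### Contraction -/

/-- `PathConn T G v u w P`: the connection `P` is obtained by linking connections along a path from
`u` to `w` in `G` that avoids the node `v`. -/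
inductive PathConn (T : Timetable B Z) (G : Graph B Z) (v u : B) : B → Conn B Z → Prop
  | edge {w : B} {P : Conn B Z} : u ≠ v → w ≠ v → P ∈ G u w → PathConn T G v u w P
  | snoc {x w : B} {P Q : Conn B Z} : PathConn T G v u x P → w ≠ v → Q ∈ G x w → T.CanLink P Q →
      PathConn T G v u w (P.link Q)

/-- The connections along the edge `(u, v)` followed by any number of traversals of the loop at `v`,
that is, along the paths `⟨u, v⟩`, `⟨u, v, v⟩`, `⟨u, v, v, v⟩`, … -/
inductive LoopConn (T : Timetable B Z) (G : Graph B Z) (v u : B) : Conn B Z → Prop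
  | edge {P : Conn B Z} : P ∈ G u v → LoopConn T G v u P
  | loop {P Q : Conn B Z} : LoopConn T G v u P → Q ∈ G v v → T.CanLink P Q →
      LoopConn T G v u (P.link Q)

/-- The connections that a shortcut `(u, w)` for the node `v` has to represent: those along
`⟨u, v, w⟩` and, if there is a loop at `v`, along `⟨u, v, v, w⟩`, `⟨u, v, v, v, w⟩`, … -/
def shortcut (T : Timetable B Z) (G : Graph B Z) (v u w : B) : Set (Conn B Z) :=
  {R | ∃ P Q, LoopConn T G v u P ∧ Q ∈ G v w ∧ T.CanLink P Q ∧ R = P.link Q}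

/-- `G'` is a result of contracting the node `v` in the graph `G`. The node `v` and its edges are
removed. A shortcut may be added between any two remaining stations `u`, `w`, a loop if `u = w`; it
is merged with an edge `(u, w)` that exists already, and dominated connections may be dropped in the
merge. A connection of a shortcut can only be left out if a witness dominates it, that is, a
connection along a path from `u` to `w` in `G` that avoids `v` (there is no obligation to find
witnesses). -/
structure Contracts (T : Timetable B Z) (v : B) (G G' : Graph B Z) : Prop where
  removed : ∀ u w, u = v ∨ w = v → G' u w = ∅
  sub : ∀ u w, u ≠ v → w ≠ v → G' u w ⊆ G u w ∪ shortcut T G v u w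
  merged : ∀ u w, u ≠ v → w ≠ v → ∀ Q ∈ G u w, ∃ P ∈ G' u w, T.Dominates P Q
  shortcuts : ∀ u w, u ≠ v → w ≠ v → ∀ Q ∈ shortcut T G v u w,
    (∃ P ∈ G' u w, T.Dominates P Q) ∨ (∃ P, PathConn T G v u w P ∧ T.Dominates P Q)

/-- A station graph contraction hierarchy: all (finitely many) stations are contracted one after the
other, in an arbitrary order. `graph i` is the remaining graph after `i` contractions. -/
structure Hierarchy (T : Timetable B Z) where
  n : ℕ
  order : Fin n ≃ B
  graph : ℕ → Graph B Z
  graph_zero : graph 0 = T.stationGraph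
  contracts : ∀ i : Fin n, Contracts T (order i) (graph i) (graph (i + 1))

namespace Hierarchy

variable {T : Timetable B Z}

/-- The position of a station in the contraction order. -/
def rank (H : Hierarchy T) (u : B) : ℕ := H.order.symm u

/-- The edges of the hierarchy: the edge `(u, w)` as it was when the first of its end points was
contracted (thus with all the shortcuts that were merged into it). -/
def edge (H : Hierarchy T) : Graph B Z := fun u w => H.graph (min (H.rank u) (H.rank w)) u w

end Hierarchy

/-! ### The hierarchical time query -/

/-- An arrival connection, stored with a station. The stop event is `none` for the special initial
stop event `∀`, from which every train that departs not earlier can be boarded. -/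
structure Arrival (Z : Type*) where
  arr : ℤ
  event : Option Z

namespace Timetable

/-- An arrival connection at the station `S` can be linked with `Q`. -/
def CanBoard (T : Timetable B Z) (S : B) (P : Arrival Z) (Q : Conn B Z) : Prop :=
  match P.event with
  | none => P.arr ≤ Q.dep
  | some z => T.minWait S z Q.Z1 ≤ Q.dep - P.arr

/-- Domination of arrival connections at the station `S`. The initial one allows boarding all
trains, hence it dominates all later ones, and is dominated by no others. -/
def DominatesArr (T : Timetable B Z) (S : B) (P Q : Arrival Z) : Prop :=
  P.arr ≤ Q.arr ∧
    match P.event, Q.event with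
    | none, _ => True
    | some _, none => False
    | some z, some z' => z' = z ∨ ¬ T.CriticalArr S z' Q.arr ∨
        ∃ t, T.IsNextDep S z' Q.arr t ∧ T.transfer S ≤ t - P.arr

/-- The link operation: the arrival connections `X` at the station `S`, linked with an edge that
starts in `S` and holds the connections `E`. -/
def linkArr (T : Timetable B Z) (S : B) (X : Set (Arrival Z)) (E : Set (Conn B Z)) :
    Set (Arrival Z) :=
  {R | ∃ P ∈ X, ∃ Q ∈ E, T.CanBoard S P Q ∧ R = ⟨Q.arr, some Q.Z2⟩}

/-- The minimum operation: `N` is a dominant set of the arrival connections at `S` that are in `old`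
or `new`. Of several equivalent ones only one is kept, from `old` if available. -/
structure IsMinimum (T : Timetable B Z) (S : B) (old new N : Set (Arrival Z)) : Prop where
  sub : N ⊆ old ∪ new
  dominating : ∀ Q ∈ old ∪ new, ∃ P ∈ N, T.DominatesArr S P Q
  dominant : ∀ P ∈ N, ∀ Q ∈ N, T.DominatesArr S P Q → P = Q
  prefer_old : ∀ Q ∈ N, Q ∉ old → ∀ P ∈ old, ¬ T.DominatesArr S P Q

end Timetable

/-- The configurations of the query algorithm. The backward search has a FIFO queue and the set of
visited nodes. The forward search has the nodes that the backward search has visited (`corridor`),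
the sets `ac` of arrival connections, and the priority queue `Q`, where `Q S` is the key of `S`, or
`none` if `S` is not in the queue. It is either at the head of its main loop (`forward`) or is
processing the edges from `S` to the nodes in `todo` (`relaxing`). -/
inductive Config (B Z : Type*)
  | backward (queue : List B) (visited : Set B)
  | forward (corridor : Set B) (ac : B → Set (Arrival Z)) (Q : B → Option ℤ)
  | relaxing (corridor : Set B) (S : B) (todo : Set B) (ac : B → Set (Arrival Z))
      (Q : B → Option ℤ)
  | done (result : Option ℤ)

namespace Hierarchy

variable {T : Timetable B Z}

/-- The edges that the forward search relaxes: those that do not lead downwards (in particular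
loops), and the downward edges in the corridor of the backward search. -/
def SearchEdge (H : Hierarchy T) (corridor : Set B) (S S' : B) : Prop :=
  (H.edge S S').Nonempty ∧ (H.rank S ≤ H.rank S' ∨ S' ∈ corridor)

open Classical in
/-- One step of the time query `(a, b, t₀)` in the hierarchy. First a breadth first search from `b`
visits backwards all edges that lead downwards. Then follows the label correcting forward search
from `a`. Ties between minimal keys, the order of the edges, and the choices in the minimum
operation are left open. -/
inductive Step (H : Hierarchy T) (a b : B) (t₀ : ℤ) : Config B Z → Config B Z → Prop
  | visit {S' : B} {queue new : List B} {visited : Set B} :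
      new.Nodup →
      (∀ S, S ∈ new ↔ S ∉ visited ∧ (H.edge S S').Nonempty ∧ H.rank S' < H.rank S) →
      Step H a b t₀ (.backward (S' :: queue) visited)
        (.backward (queue ++ new) (visited ∪ {S | S ∈ new}))
  | start {visited : Set B} :
      Step H a b t₀ (.backward [] visited)
        (.forward visited
          (Function.update (fun _ => ∅) a {⟨t₀, none⟩})
          (Function.update (fun _ => none) a (some t₀)))
  | found {corridor : Set B} {ac : B → Set (Arrival Z)} {Q : B → Option ℤ} {t : ℤ} :
      Q b = some t → (∀ S' t', Q S' = some t' → t ≤ t') →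
      Step H a b t₀ (.forward corridor ac Q) (.done (some t))
  | deleteMin {corridor : Set B} {ac : B → Set (Arrival Z)} {Q : B → Option ℤ} {S : B} {t : ℤ} :
      S ≠ b → Q S = some t → (∀ S' t', Q S' = some t' → t ≤ t') →
      Step H a b t₀ (.forward corridor ac Q)
        (.relaxing corridor S {S' | H.SearchEdge corridor S S'} ac (Function.update Q S none))
  | keep {corridor todo : Set B} {ac : B → Set (Arrival Z)} {Q : B → Option ℤ} {S S' : B} :
      S' ∈ todo →
      T.IsMinimum S' (ac S') (T.linkArr S (ac S) (H.edge S S')) (ac S') →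
      Step H a b t₀ (.relaxing corridor S todo ac Q) (.relaxing corridor S (todo \ {S'}) ac Q)
  | improve {corridor todo : Set B} {ac : B → Set (Arrival Z)} {Q : B → Option ℤ} {S S' : B}
      {N : Set (Arrival Z)} {k : ℤ} :
      S' ∈ todo →
      T.IsMinimum S' (ac S') (T.linkArr S (ac S) (H.edge S S')) N → N ≠ ac S' →
      IsLeast (Arrival.arr '' N) k →
      Step H a b t₀ (.relaxing corridor S todo ac Q)
        (.relaxing corridor S (todo \ {S'}) (Function.update ac S' N)
          (Function.update Q S' (some k)))
  | next {corridor : Set B} {ac : B → Set (Arrival Z)} {Q : B → Option ℤ} {S : B} :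
      Step H a b t₀ (.relaxing corridor S ∅ ac Q) (.forward corridor ac Q)
  | exhausted {corridor : Set B} {ac : B → Set (Arrival Z)} {Q : B → Option ℤ} :
      (∀ S, Q S = none) →
      Step H a b t₀ (.forward corridor ac Q) (.done none)

/-- The initial configuration of a time query with target `b`. -/
def initial (_H : Hierarchy T) (b : B) : Config B Z := .backward [b] {b}

end Hierarchy

end StationGraph

/-!
Only one consequence of domination matters: a connection that dominates another can replace it in
every consistent connection. Replaceability is transitive and compatible with linking, so each
contraction preserves all walks between remaining stations up to replacement: what lies between two
passages through remaining stations belongs to an old edge or to a shortcut, and it survives up to a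
dominating connection or a witness.

By induction over the contractions, from the last to the first, every journey to `b` can be
replaced by one along edges that the forward search relaxes. If the walk starts at the station to be
contracted next, then its first edge leads upwards or is a loop. Otherwise it is rewritten to avoid
that station, except that it may end there, and then its last part goes down to it, along an edge
that the backward search marks.

The forward search keeps the invariant that the edges out of the stations outside the queue are
settled: linking along them yields only arrival connections that are already dominated. Since no
journey arrives before it departs, a journey that arrives before the minimal key passes through
such stations only, so its arrival is dominated at `b`. The search terminates because a change of
the arrival connections at a station properly shrinks the finite set of undominated ones.
-/

namespace StationGraph

variable {B Z : Type*} {T : Timetable B Z} {G G' : Graph B Z} {u v w x : B} {P Q R : Conn B Z}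

/-! ### Walks and journeys -/

/-- `WalkConn T G u w P`: the connection `P` is obtained by linking connections along a walk from
`u` to `w` in `G`. This is `PathConn` without a node to avoid. -/
inductive WalkConn (T : Timetable B Z) (G : Graph B Z) (u : B) : B → Conn B Z → Prop
  | edge {w : B} {P : Conn B Z} : P ∈ G u w → WalkConn T G u w P
  | snoc {x w : B} {P Q : Conn B Z} : WalkConn T G u x P → Q ∈ G x w → T.CanLink P Q →
      WalkConn T G u w (P.link Q)

namespace WalkConn

theorem append (hP : WalkConn T G u x P) (hQ : WalkConn T G x w Q) (hPQ : T.CanLink P Q) :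
    WalkConn T G u w (P.link Q) := by
  induction hQ with
  | edge hQ => exact hP.snoc hQ hPQ
  | @snoc y w Q R _ hR hQR ih => exact snoc (P := P.link Q) (Q := R) (ih hPQ) hR hQR

theorem bind (hG : ∀ ⦃x y Q⦄, Q ∈ G x y → WalkConn T G' x y Q) (hP : WalkConn T G u w P) :
    WalkConn T G' u w P := by
  induction hP with
  | edge hP => exact hG hP
  | snoc _ hQ hPQ ih => exact ih.append (hG hQ) hPQ

theorem mono (hG : G ≤ G') (hP : WalkConn T G u w P) : WalkConn T G' u w P :=
  hP.bind fun x y _ hQ => edge (hG x y hQ)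

theorem head_induction_on {motive : B → Conn B Z → Prop} (hP : WalkConn T G u w P)
    (edge : ∀ {u P}, P ∈ G u w → motive u P)
    (cons : ∀ {u x P Q}, P ∈ G u x → WalkConn T G x w Q → T.CanLink P Q → motive x Q →
      motive u (P.link Q)) :
    motive u P := by
  have prepend {x P} (hP : WalkConn T G u x P) : ∀ {R}, WalkConn T G x w R → T.CanLink P R →
      motive x R → motive u (P.link R) := by
    induction hP with
    | edge hP => exact fun hR => cons hP hR
    | @snoc y z P Q _ hQ hPQ ih =>
      exact fun {R} hR hQR hmR =>
        ih (R := Q.link R) ((WalkConn.edge hQ).append hR hQR) hPQ (cons hQ hR hQR hmR)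
  cases hP with
  | edge hP => exact edge hP
  | snoc hP hQ hPQ => exact prepend hP (.edge hQ) hPQ (edge hQ)

end WalkConn

theorem LoopConn.walkConn (hP : LoopConn T G v u P) : WalkConn T G u v P := by
  induction hP with
  | edge hP => exact .edge hP
  | loop _ hQ hPQ ih => exact ih.snoc hQ hPQ

/-- The connection that consists of riding the elementary connection `x.1` with departure at time
`x.2`. -/
def ride (x : ElemConn B Z × ℤ) : Conn B Z :=
  ⟨x.1.Z1, x.1.Z2, x.1.S1, x.1.S2, x.2, x.1.length + x.2⟩

namespace Timetable

theorem mem_stationGraph :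
    P ∈ T.stationGraph u w ↔ ∃ x, T.Runs x ∧ P = ride x ∧ x.1.S1 = u ∧ x.1.S2 = w := by
  constructor
  · rintro ⟨c, d, hrun, rfl, rfl, rfl⟩
    exact ⟨(c, d), hrun, rfl, rfl, rfl⟩
  · rintro ⟨⟨c, d⟩, hrun, rfl, rfl, rfl⟩
    exact ⟨c, d, hrun, rfl, rfl, rfl⟩

theorem dep_le_arr_of_mem_stationGraph (hP : P ∈ T.stationGraph u w) : P.dep ≤ P.arr := by
  obtain ⟨x, -, rfl, -, -⟩ := mem_stationGraph.1 hP
  exact le_add_of_nonneg_left (Int.emod_nonneg _ (by norm_num))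

/-- `P` is the connection from `u` to `w` that results from linking the rides of a consistent
connection, see `isJourney_iff_exists_isChain`. -/
abbrev IsJourney (T : Timetable B Z) (u w : B) (P : Conn B Z) : Prop :=
  WalkConn T T.stationGraph u w P

theorem isJourney_of_isChain {L : List (ElemConn B Z × ℤ)} {x y : ElemConn B Z × ℤ}
    (hruns : ∀ z ∈ x :: L, T.Runs z) (hchain : (x :: L).IsChain T.Follows)
    (hlast : (x :: L).getLast? = some y) :
    T.IsJourney x.1.S1 y.1.S2 ((ride x).link (ride y)) := by
  have hx : ride x ∈ T.stationGraph x.1.S1 x.1.S2 :=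
    mem_stationGraph.2 ⟨x, hruns x (by simp), rfl, rfl, rfl⟩
  induction L generalizing x with
  | nil =>
    obtain rfl : x = y := by simpa using hlast
    exact .edge hx
  | cons x' L ih =>
    obtain ⟨hfollows, hchain⟩ := List.isChain_cons_cons.1 hchain
    have htail : T.IsJourney x'.1.S1 y.1.S2 ((ride x').link (ride y)) :=
      ih (fun z hz => hruns z (.tail _ hz)) hchain (by simpa using hlast)
        (mem_stationGraph.2 ⟨x', hruns x' (by simp), rfl, rfl, rfl⟩)
    rw [← hfollows.1] at htail
    exact (WalkConn.edge hx).append (Q := (ride x').link (ride y)) htail hfollows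

theorem isJourney_iff_exists_isChain :
    T.IsJourney u w P ↔ ∃ (L : List (ElemConn B Z × ℤ)) (x y : ElemConn B Z × ℤ),
      (∀ z ∈ L, T.Runs z) ∧ L.IsChain T.Follows ∧
      L.head? = some x ∧ L.getLast? = some y ∧ P = (ride x).link (ride y) ∧
      x.1.S1 = u ∧ y.1.S2 = w := by
  constructor
  · intro hP
    induction hP with
    | edge hP =>
      obtain ⟨x, hx, rfl, hS1, hS2⟩ := mem_stationGraph.1 hP
      exact ⟨[x], x, x, by simpa using hx, by simp, rfl, rfl, rfl, hS1, hS2⟩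
    | snoc _ hQ hPQ ih =>
      obtain ⟨L, x, y, hruns, hchain, hhead, hlast, rfl, hS1, -⟩ := ih
      obtain ⟨z, hz, rfl, -, hS2⟩ := mem_stationGraph.1 hQ
      have hyz : T.Follows y z := hPQ
      exact ⟨L ++ [z], x, z, List.forall_mem_append.2 ⟨hruns, List.forall_mem_singleton.2 hz⟩,
        List.isChain_append.2 ⟨hchain, .singleton z, by simpa [hlast] using hyz⟩,
        by simp [hhead], by simp, rfl, hS1, hS2⟩
  · rintro ⟨_ | ⟨x', L⟩, x, y, hruns, hchain, hhead, hlast, rfl, rfl, rfl⟩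
    · simp at hhead
    · obtain rfl : x' = x := by simpa using hhead
      exact isJourney_of_isChain hruns hchain hlast

theorem reaches_iff_exists_isJourney {a b : B} {t₀ t : ℤ} :
    T.Reaches a b t₀ t ↔
      (b = a ∧ t = t₀) ∨ ∃ P, T.IsJourney a b P ∧ t₀ ≤ P.dep ∧ P.arr = t := by
  refine or_congr_right ⟨?_, ?_⟩
  · rintro ⟨L, _, ⟨hruns, hchain, ⟨x, hhead, hS1, rfl⟩, ⟨y, hlast, hS2, rfl⟩⟩, hdep⟩
    exact ⟨_, isJourney_iff_exists_isChain.2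
      ⟨L, x, y, hruns, hchain, hhead, hlast, rfl, hS1, hS2⟩, hdep, rfl⟩
  · rintro ⟨P, hP, hdep, rfl⟩
    obtain ⟨L, x, y, hruns, hchain, hhead, hlast, rfl, hS1, hS2⟩ :=
      isJourney_iff_exists_isChain.1 hP
    exact ⟨L, _, ⟨hruns, hchain, ⟨x, hhead, hS1, rfl⟩, ⟨y, hlast, hS2, rfl⟩⟩, hdep⟩

namespace IsJourney

theorem exists_runs (hP : T.IsJourney u w P) : ∃ x y, T.Runs x ∧ T.Runs y ∧
    P = (ride x).link (ride y) ∧ x.1.S1 = u ∧ y.1.S2 = w := by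
  obtain ⟨L, x, y, hruns, -, hhead, hlast, hPxy⟩ := isJourney_iff_exists_isChain.1 hP
  exact ⟨x, y, hruns x (List.mem_of_head? hhead), hruns y (List.mem_of_getLast? hlast), hPxy⟩

theorem S1_eq (hP : T.IsJourney u w P) : P.S1 = u := by
  obtain ⟨x, y, -, -, rfl, hS1, -⟩ := hP.exists_runs
  exact hS1

theorem S2_eq (hP : T.IsJourney u w P) : P.S2 = w := by
  obtain ⟨x, y, -, -, rfl, -, hS2⟩ := hP.exists_runs
  exact hS2

end IsJourney

theorem minWait_nonneg (T : Timetable B Z) (S : B) (z z' : Z) : 0 ≤ T.minWait S z z' := by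
  unfold minWait
  split_ifs <;> omega

theorem minWait_le_transfer (T : Timetable B Z) (S : B) (z z' : Z) :
    T.minWait S z z' ≤ T.transfer S := by
  unfold minWait
  split_ifs <;> omega

theorem minWait_self (T : Timetable B Z) (S : B) (z : Z) : T.minWait S z z = 0 :=
  if_pos rfl

theorem minWait_of_ne {S : B} {z z' : Z} (h : z' ≠ z) : T.minWait S z z' = T.transfer S :=
  if_neg h

theorem CanLink.arr_le_dep (h : T.CanLink P Q) : P.arr ≤ Q.dep :=
  sub_nonneg.1 ((T.minWait_nonneg ..).trans h.2)

theorem IsJourney.dep_le_arr (hP : T.IsJourney u w P) : P.dep ≤ P.arr := by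
  induction hP with
  | edge hP => exact dep_le_arr_of_mem_stationGraph hP
  | snoc _ hQ hPQ ih =>
    exact ih.trans (hPQ.arr_le_dep.trans (dep_le_arr_of_mem_stationGraph hQ))

end Timetable

/-! ### Domination -/

theorem cycleDiff_le {s t d e : ℤ} (hd : d ≡ s [ZMOD 1440]) (he : e ≡ t [ZMOD 1440])
    (hde : d ≤ e) : cycleDiff s t ≤ e - d := by
  have : (t - s) % 1440 = (e - d) % 1440 := ((he.sub hd).symm : _ ≡ _ [ZMOD 1440])
  rw [cycleDiff, this]
  omega

theorem cycleDiff_nonneg (t t' : ℤ) : 0 ≤ cycleDiff t t' :=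
  Int.emod_nonneg _ (by norm_num)

theorem add_cycleDiff_modEq (t t' : ℤ) : t + cycleDiff t t' ≡ t' [ZMOD 1440] := by
  simpa [cycleDiff] using (Int.mod_modEq (t' - t) 1440).add_left t

namespace Timetable

theorem Runs.arr_modEq {y : ElemConn B Z × ℤ} (hy : T.Runs y) :
    (ride y).arr ≡ y.1.ta [ZMOD 1440] := by
  have h := (hy.2.2.add_right y.1.length).trans (add_cycleDiff_modEq y.1.td y.1.ta)
  rwa [add_comm] at h

namespace IsJourney

theorem exists_isNextDep (hP : T.IsJourney u w P) (d : ℤ) : ∃ t, T.IsNextDep u P.Z1 d t := by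
  obtain ⟨x, y, hx, -, rfl, hS1, -⟩ := hP.exists_runs
  exact ⟨_, x.1, hx.1, hS1, rfl, rfl⟩

theorem nextDep_le_dep (hP : T.IsJourney u w P) {d t : ℤ} (ht : T.IsNextDep u P.Z1 d t)
    (hd : d ≤ P.dep) : t ≤ P.dep := by
  obtain ⟨x, y, hx, -, rfl, hS1, -⟩ := hP.exists_runs
  obtain ⟨c, hc, hcS1, hcZ1, rfl⟩ := ht
  obtain rfl : c = x.1 := T.dep_unique c hc x.1 hx.1 (hcS1.trans hS1.symm) hcZ1
  exact le_sub_iff_add_le'.1 (cycleDiff_le rfl hx.2.2 hd)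

theorem exists_isPrevArr (hP : T.IsJourney u w P) (d : ℤ) : ∃ t, T.IsPrevArr w P.Z2 d t := by
  obtain ⟨x, y, -, hy, rfl, -, hS2⟩ := hP.exists_runs
  exact ⟨_, y.1, hy.1, hS2, rfl, rfl⟩

theorem arr_le_prevArr (hP : T.IsJourney u w P) {d t : ℤ} (ht : T.IsPrevArr w P.Z2 d t)
    (hd : P.arr ≤ d) : P.arr ≤ t := by
  obtain ⟨x, y, -, hy, rfl, -, hS2⟩ := hP.exists_runs
  obtain ⟨c, hc, hcS2, hcZ2, rfl⟩ := ht
  obtain rfl : c = y.1 := T.arr_unique c hc y.1 hy.1 (hcS2.trans hS2.symm) hcZ2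
  exact le_sub_comm.1 (cycleDiff_le hy.arr_modEq rfl hd)

theorem transfer_le_of_not_criticalArr (hP : T.IsJourney u w P) {d : ℤ}
    (hcrit : ¬ T.CriticalArr u P.Z1 d) (hd : d ≤ P.dep) : T.transfer u ≤ P.dep - d := by
  obtain ⟨t, ht⟩ := hP.exists_isNextDep d
  have htransfer : T.transfer u ≤ t - d := not_lt.1 fun hlt => hcrit ⟨t, ht, hlt⟩
  exact htransfer.trans (sub_le_sub_right (hP.nextDep_le_dep ht hd) d)

theorem transfer_le_of_not_criticalDep (hP : T.IsJourney u w P) {d : ℤ}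
    (hcrit : ¬ T.CriticalDep w P.Z2 d) (hd : P.arr ≤ d) : T.transfer w ≤ d - P.arr := by
  obtain ⟨t, ht⟩ := hP.exists_isPrevArr d
  have htransfer : T.transfer w ≤ d - t := not_lt.1 fun hlt => hcrit ⟨t, ht, hlt⟩
  exact htransfer.trans (sub_le_sub_left (hP.arr_le_prevArr ht hd) d)

end IsJourney

theorem IsNextDep.exists_isNextDep {S : B} {z : Z} {d t : ℤ} (ht : T.IsNextDep S z d t)
    (d' : ℤ) : ∃ t', T.IsNextDep S z d' t' := by
  obtain ⟨c, hc, hS1, hZ1, -⟩ := ht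
  exact ⟨_, c, hc, hS1, hZ1, rfl⟩

theorem IsNextDep.mono {S : B} {z : Z} {d d' t t' : ℤ} (ht : T.IsNextDep S z d t)
    (ht' : T.IsNextDep S z d' t') (hd : d ≤ d') : t ≤ t' := by
  obtain ⟨c, hc, hS1, hZ1, rfl⟩ := ht
  obtain ⟨c', hc', hS1', hZ1', rfl⟩ := ht'
  obtain rfl := T.dep_unique c hc c' hc' (hS1.trans hS1'.symm) (hZ1.trans hZ1'.symm)
  exact le_sub_iff_add_le'.1 (cycleDiff_le rfl (add_cycleDiff_modEq d' c.td)
    (hd.trans (le_add_of_nonneg_right (cycleDiff_nonneg d' c.td))))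

end Timetable

/-- The arrival connection with which the journey `P` ends. -/
def Conn.arrival (P : Conn B Z) : Arrival Z := ⟨P.arr, some P.Z2⟩

namespace Timetable

variable {S : B} {L M N : Arrival Z}

theorem DominatesArr.refl (T : Timetable B Z) (S : B) (L : Arrival Z) :
    T.DominatesArr S L L := by
  rcases L with ⟨t, _ | z⟩ <;> simp [DominatesArr]

theorem DominatesArr.trans (hLM : T.DominatesArr S L M) (hMN : T.DominatesArr S M N) :
    T.DominatesArr S L N := by
  obtain ⟨harr, hLM⟩ := hLM
  obtain ⟨harr', hMN⟩ := hMN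
  refine ⟨harr.trans harr', ?_⟩
  rcases L with ⟨l, _ | zl⟩
  · trivial
  rcases M with ⟨m, _ | zm⟩
  · exact hLM.elim
  rcases N with ⟨n, _ | zn⟩
  · exact hMN.elim
  dsimp only at *
  rcases hMN with rfl | hcrit | ⟨t, ht, htransfer⟩
  · by_cases hcrit' : T.CriticalArr S zn n
    · obtain ⟨t, ht, -⟩ := hcrit'
      obtain ⟨s, hs⟩ := ht.exists_isNextDep m
      have hst : s ≤ t := hs.mono ht harr'
      rcases hLM with hz | hcrit | ⟨s', hs', htransfer⟩
      · exact .inl hz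
      · have : T.transfer S ≤ s - m := not_lt.1 fun hlt => hcrit ⟨s, hs, hlt⟩
        exact .inr (.inr ⟨t, ht, by omega⟩)
      · have : s' ≤ t := hs'.mono ht harr'
        exact .inr (.inr ⟨t, ht, by omega⟩)
    · exact .inr (.inl hcrit')
  · exact .inr (.inl hcrit)
  · exact .inr (.inr ⟨t, ht, by omega⟩)

theorem CanBoard.arr_le_dep (h : T.CanBoard S L P) : L.arr ≤ P.dep := by
  rcases L with ⟨l, _ | z⟩
  · exact h
  · exact sub_nonneg.1 ((T.minWait_nonneg ..).trans h)

theorem DominatesArr.canBoard (h : T.DominatesArr u L M) (hP : T.IsJourney u w P)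
    (hMP : T.CanBoard u M P) : T.CanBoard u L P := by
  have harr_dep : M.arr ≤ P.dep := hMP.arr_le_dep
  obtain ⟨harr, h⟩ := h
  rcases L with ⟨l, _ | zl⟩
  · exact harr.trans harr_dep
  rcases M with ⟨m, _ | zm⟩
  · exact h.elim
  dsimp only [CanBoard] at *
  have hwait := T.minWait_le_transfer u zl P.Z1
  by_cases hz : P.Z1 = zm
  · subst hz
    rcases h with rfl | hcrit | ⟨t, ht, htransfer⟩
    · rw [minWait_self]
      omega
    · have := hP.transfer_le_of_not_criticalArr hcrit harr_dep
      omega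
    · have := hP.nextDep_le_dep ht harr_dep
      omega
  · rw [minWait_of_ne hz] at hMP
    omega

/-- `P` can replace `Q` in every consistent connection. This is all that is needed of domination,
but unlike `Dominates` it is evidently transitive and compatible with linking. -/
structure Replaces (T : Timetable B Z) (P Q : Conn B Z) : Prop where
  dep : Q.dep ≤ P.dep
  arr : P.arr ≤ Q.arr
  canLink_left : ∀ ⦃u w R⦄, T.IsJourney u w R → T.CanLink R Q → T.CanLink R P
  canLink_right : ∀ ⦃u w R⦄, T.IsJourney u w R → T.CanLink Q R → T.CanLink P R

namespace Replaces

variable {P' Q' : Conn B Z}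

theorem refl (T : Timetable B Z) (P : Conn B Z) : T.Replaces P P :=
  ⟨le_rfl, le_rfl, fun _ _ _ _ h => h, fun _ _ _ _ h => h⟩

theorem trans (hPQ : T.Replaces P Q) (hQR : T.Replaces Q R) : T.Replaces P R where
  dep := hQR.dep.trans hPQ.dep
  arr := hPQ.arr.trans hQR.arr
  canLink_left _ _ _ hS h := hPQ.canLink_left hS (hQR.canLink_left hS h)
  canLink_right _ _ _ hS h := hPQ.canLink_right hS (hQR.canLink_right hS h)

theorem link (hP : T.Replaces P P') (hQ : T.Replaces Q Q') :
    T.Replaces (P.link Q) (P'.link Q') :=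
  ⟨hP.dep, hQ.arr, hP.canLink_left, hQ.canLink_right⟩

end Replaces

namespace Dominates

theorem dominatesArr (h : T.Dominates P Q) : T.DominatesArr Q.S2 P.arrival Q.arrival :=
  ⟨h.2.1.2, h.1.2 ▸ h.2.2.2⟩

theorem canLink_left (h : T.Dominates P Q) (hR : T.IsJourney u w R) (hRQ : T.CanLink R Q) :
    T.CanLink R P := by
  obtain ⟨⟨hS1, -⟩, ⟨hdep, -⟩, hcritical, -⟩ := h
  have harr_dep : R.arr ≤ Q.dep := hRQ.arr_le_dep
  obtain ⟨hRS2, hwait⟩ := hRQ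
  refine ⟨hRS2.trans hS1.symm, ?_⟩
  have hwait' := T.minWait_le_transfer R.S2 R.Z2 P.Z1
  rw [hS1, ← hRS2, hR.S2_eq] at hcritical
  rw [hR.S2_eq] at hwait hwait' ⊢
  by_cases hz : Q.Z1 = R.Z2
  · rcases hcritical with hz' | hcrit | ⟨t, ht, htransfer⟩
    · rw [← hz']
      omega
    · have := hR.transfer_le_of_not_criticalDep (hz ▸ hcrit) harr_dep
      omega
    · have := hR.arr_le_prevArr (hz ▸ ht) harr_dep
      omega
  · rw [minWait_of_ne hz] at hwait
    omega

theorem canLink_right (h : T.Dominates P Q) (hR : T.IsJourney u w R) (hQR : T.CanLink Q R) :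
    T.CanLink P R := by
  have hQS2 : Q.S2 = u := hQR.1.trans hR.S1_eq
  have hboard : T.CanBoard u P.arrival R :=
    (hQS2 ▸ h.dominatesArr).canBoard hR (hQS2 ▸ hQR.2)
  exact ⟨h.1.2.trans hQR.1, (h.1.2.trans hQS2).symm ▸ hboard⟩

theorem replaces (h : T.Dominates P Q) : T.Replaces P Q :=
  ⟨h.2.1.1, h.2.1.2, fun _ _ _ => h.canLink_left, fun _ _ _ => h.canLink_right⟩

end Dominates

end Timetable

/-! ### Contraction -/

/-- Every connection of the station graph `G` results from linking rides. -/
def Sound (T : Timetable B Z) (G : Graph B Z) : Prop :=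
  ∀ ⦃u w P⦄, P ∈ G u w → T.IsJourney u w P

theorem Sound.isJourney (hG : Sound T G) (hP : WalkConn T G u w P) : T.IsJourney u w P :=
  hP.bind hG

/-- Some connection along a walk from `u` to `w` in `G` can replace `P`. -/
def ReplaceableIn (T : Timetable B Z) (G : Graph B Z) (u w : B) (P : Conn B Z) : Prop :=
  ∃ P', WalkConn T G u w P' ∧ T.Replaces P' P

theorem WalkConn.replaceableIn (hP : WalkConn T G u w P) : ReplaceableIn T G u w P :=
  ⟨P, hP, .refl T P⟩

namespace ReplaceableIn

theorem mono (hP : ReplaceableIn T G u w P) (hG : G ≤ G') : ReplaceableIn T G' u w P :=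
  hP.imp fun _ h => h.imp_left (.mono hG)

theorem of_replaces (hP : ReplaceableIn T G u w P) (hPQ : T.Replaces P Q) :
    ReplaceableIn T G u w Q :=
  hP.imp fun _ h => h.imp_right fun hP' => hP'.trans hPQ

theorem append (hG : Sound T G) (hP : ReplaceableIn T G u x P) (hQ : ReplaceableIn T G x w Q)
    (hQ_journey : T.IsJourney x w Q) (hPQ : T.CanLink P Q) :
    ReplaceableIn T G u w (P.link Q) := by
  obtain ⟨P', hP', hPr⟩ := hP
  obtain ⟨Q', hQ', hQr⟩ := hQ
  have hP'Q : T.CanLink P' Q := hPr.canLink_right hQ_journey hPQ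
  exact ⟨P'.link Q', hP'.append hQ' (hQr.canLink_left (hG.isJourney hP') hP'Q), hPr.link hQr⟩

theorem bind (hG : Sound T G) (hG' : Sound T G')
    (hedge : ∀ ⦃x y Q⦄, Q ∈ G x y → ReplaceableIn T G' x y Q) (hP : ReplaceableIn T G u w P) :
    ReplaceableIn T G' u w P := by
  obtain ⟨P', hP', hPr⟩ := hP
  refine of_replaces ?_ hPr
  clear hPr
  induction hP' with
  | edge hP => exact hedge hP
  | snoc _ hQ hPQ ih => exact ih.append hG' (hedge hQ) (hG hQ) hPQ

end ReplaceableIn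

/-- The graph that results from contracting `v` in `G` if no connection is left out. -/
def bypass (T : Timetable B Z) (G : Graph B Z) (v : B) : Graph B Z := fun u w =>
  {P | u ≠ v ∧ w ≠ v ∧ P ∈ G u w ∪ shortcut T G v u w}

theorem walkConn_of_mem_bypass (hP : P ∈ bypass T G v u w) : WalkConn T G u w P := by
  obtain ⟨-, -, hP | ⟨P, Q, hP, hQ, hPQ, rfl⟩⟩ := hP
  · exact .edge hP
  · exact hP.walkConn.snoc hQ hPQ

theorem Sound.bypass (hG : Sound T G) (v : B) : Sound T (bypass T G v) :=
  fun _ _ _ hP => hG.isJourney (walkConn_of_mem_bypass hP)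

theorem WalkConn.bypass_cases (hu : u ≠ v) (hP : WalkConn T G u w P) :
    (w ≠ v ∧ WalkConn T (bypass T G v) u w P) ∨
    (w = v ∧ LoopConn T G v u P) ∨
    (w = v ∧ ∃ x P₁ P₂, x ≠ v ∧ WalkConn T (bypass T G v) u x P₁ ∧ LoopConn T G v x P₂ ∧
      T.CanLink P₁ P₂ ∧ P = P₁.link P₂) := by
  induction hP with
  | @edge w P hP =>
    by_cases hw : w = v
    · subst hw
      exact .inr (.inl ⟨rfl, .edge hP⟩)
    · exact .inl ⟨hw, .edge ⟨hu, hw, .inl hP⟩⟩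
  | @snoc x w P Q _ hQ hPQ ih =>
    by_cases hw : w = v
    · subst hw
      rcases ih with ⟨hx, hP⟩ | ⟨rfl, hP⟩ | ⟨rfl, y, P₁, P₂, hy, hP₁, hP₂, hP₁₂, rfl⟩
      · exact .inr (.inr ⟨rfl, x, P, Q, hx, hP, .edge hQ, hPQ, rfl⟩)
      · exact .inr (.inl ⟨rfl, hP.loop hQ hPQ⟩)
      · exact .inr (.inr ⟨rfl, y, P₁, P₂.link Q, hy, hP₁, hP₂.loop hQ hPQ, hP₁₂, rfl⟩)
    · refine .inl ⟨hw, ?_⟩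
      rcases ih with ⟨hx, hP⟩ | ⟨rfl, hP⟩ | ⟨rfl, y, P₁, P₂, hy, hP₁, hP₂, hP₁₂, rfl⟩
      · exact hP.snoc ⟨hx, hw, .inl hQ⟩ hPQ
      · exact .edge ⟨hu, hw, .inr ⟨P, Q, hP, hQ, hPQ, rfl⟩⟩
      · exact hP₁.snoc (Q := P₂.link Q) ⟨hy, hw, .inr ⟨P₂, Q, hP₂, hQ, hPQ, rfl⟩⟩ hP₁₂

theorem PathConn.ne_right (hP : PathConn T G v u w P) : w ≠ v := by
  cases hP <;> assumption

namespace Contracts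

variable (h : Contracts T v G G')
include h

theorem le_bypass : G' ≤ bypass T G v := by
  intro u w P hP
  by_cases huw : u = v ∨ w = v
  · simp [h.removed u w huw] at hP
  · obtain ⟨hu, hw⟩ := not_or.1 huw
    exact ⟨hu, hw, h.sub u w hu hw hP⟩

theorem sound (hG : Sound T G) : Sound T G' :=
  fun _ _ _ hP => hG.bypass v (h.le_bypass _ _ hP)

theorem replaceableIn_of_mem (hu : u ≠ v) (hw : w ≠ v) (hP : P ∈ G u w) :
    ReplaceableIn T G' u w P :=
  have ⟨P', hP', hdom⟩ := h.merged u w hu hw P hP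
  ⟨P', .edge hP', hdom.replaces⟩

theorem replaceableIn_of_pathConn (hG : Sound T G) (hP : PathConn T G v u w P) :
    ReplaceableIn T G' u w P := by
  induction hP with
  | edge hu hw hP => exact h.replaceableIn_of_mem hu hw hP
  | snoc hP hw hQ hPQ ih =>
    exact ih.append (h.sound hG) (h.replaceableIn_of_mem hP.ne_right hw hQ) (hG hQ) hPQ

theorem replaceableIn_of_mem_bypass (hG : Sound T G) (hP : P ∈ bypass T G v u w) :
    ReplaceableIn T G' u w P := by
  obtain ⟨hu, hw, hP | hP⟩ := hP
  · exact h.replaceableIn_of_mem hu hw hP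
  · rcases h.shortcuts u w hu hw P hP with ⟨P', hP', hdom⟩ | ⟨P', hP', hdom⟩
    · exact ⟨P', .edge hP', hdom.replaces⟩
    · exact (h.replaceableIn_of_pathConn hG hP').of_replaces hdom.replaces

theorem replaceableIn_of_walkConn_bypass (hG : Sound T G)
    (hP : WalkConn T (bypass T G v) u w P) : ReplaceableIn T G' u w P :=
  hP.replaceableIn.bind (hG.bypass v) (h.sound hG) fun _ _ _ => h.replaceableIn_of_mem_bypass hG

end Contracts

/-! ### Walks in the hierarchy -/

namespace Hierarchy

variable (H : Hierarchy T)

theorem rank_order (i : Fin H.n) : H.rank (H.order i) = i := by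
  simp [rank]

theorem rank_lt (u : B) : H.rank u < H.n :=
  (H.order.symm u).isLt

theorem rank_injective : Function.Injective H.rank :=
  Fin.val_injective.comp H.order.symm.injective

theorem sound_graph {i : ℕ} (hi : i ≤ H.n) : Sound T (H.graph i) := by
  induction i with
  | zero => exact fun _ _ _ hP => .edge (H.graph_zero ▸ hP)
  | succ i ih => exact (H.contracts ⟨i, hi⟩).sound (ih (Nat.le_of_succ_le hi))

theorem sound_edge : Sound T H.edge :=
  fun u _ _ hP => H.sound_graph (min_le_of_left_le (H.rank_lt u).le) hP

theorem le_rank_of_walkConn {i : ℕ} (hi : i ≤ H.n) (hP : WalkConn T (H.graph i) u w P) :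
    i ≤ H.rank u ∧ i ≤ H.rank w := by
  induction i generalizing u w P with
  | zero => simp only [zero_le, and_self]
  | succ i ih =>
    have hne {x : B} (hx : x ≠ H.order ⟨i, hi⟩) : i ≠ H.rank x := fun h =>
      hx (H.rank_injective (h.symm.trans (H.rank_order ⟨i, hi⟩).symm))
    have hedge {x y Q} (hQ : Q ∈ H.graph (i + 1) x y) : i < H.rank x ∧ i < H.rank y := by
      have hQ' := (H.contracts ⟨i, hi⟩).le_bypass _ _ hQ
      have hle := ih (Nat.le_of_succ_le hi) (walkConn_of_mem_bypass hQ')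
      exact ⟨hle.1.lt_of_ne (hne hQ'.1), hle.2.lt_of_ne (hne hQ'.2.1)⟩
    induction hP with
    | edge hP => exact hedge hP
    | snoc _ hQ _ ihP => exact ⟨ihP.1, (hedge hQ).2⟩

theorem mem_edge_of_mem_graph {i : Fin H.n} (hP : P ∈ H.graph i u w)
    (h : u = H.order i ∨ w = H.order i) : P ∈ H.edge u w := by
  obtain ⟨hu, hw⟩ := H.le_rank_of_walkConn i.2.le (.edge hP)
  have hmin : min (H.rank u) (H.rank w) = i := by
    rcases h with rfl | rfl <;> simp_all only [rank_order, min_eq_left, min_eq_right]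
  rwa [edge, hmin]

/-- The edges of the hierarchy that lead downwards, which the backward search follows. -/
def Down (u w : B) : Prop := (H.edge u w).Nonempty ∧ H.rank w < H.rank u

/-- The edges that lead upwards, the loops, and the downward edges from which one can continue
downwards to the target `b`. The forward search relaxes all of these edges. -/
def searchGraph (b : B) : Graph B Z := fun u w =>
  {P | P ∈ H.edge u w ∧ (H.rank u ≤ H.rank w ∨ Relation.ReflTransGen H.Down w b)}

theorem sound_searchGraph (b : B) : Sound T (H.searchGraph b) :=
  fun _ _ _ hP => H.sound_edge hP.1

theorem searchGraph_le_of_down {b c : B} (h : H.Down b c) : H.searchGraph b ≤ H.searchGraph c :=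
  fun _ _ _ hP => ⟨hP.1, hP.2.imp_right fun hdown => hdown.tail h⟩

variable {H}

theorem mem_searchGraph_of_mem_graph {i : Fin H.n} (hP : P ∈ H.graph i (H.order i) w) (b : B) :
    P ∈ H.searchGraph b (H.order i) w := by
  refine ⟨H.mem_edge_of_mem_graph hP (.inl rfl), .inl ?_⟩
  rw [rank_order]
  exact (H.le_rank_of_walkConn i.2.le (.edge hP)).2

theorem down_and_walkConn_of_loopConn {i : Fin H.n} (hu : u ≠ H.order i)
    (hP : LoopConn T (H.graph i) (H.order i) u P) :
    H.Down u (H.order i) ∧ WalkConn T (H.searchGraph (H.order i)) u (H.order i) P := by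
  induction hP with
  | edge hP =>
    have hedge := H.mem_edge_of_mem_graph hP (.inr rfl)
    have hle : H.rank (H.order i) ≤ H.rank u :=
      H.rank_order i ▸ (H.le_rank_of_walkConn i.2.le (.edge hP)).1
    exact ⟨⟨⟨_, hedge⟩, hle.lt_of_ne (H.rank_injective.ne hu.symm)⟩, .edge ⟨hedge, .inr .refl⟩⟩
  | loop _ hQ hPQ ih => exact ⟨ih.1, ih.2.snoc (mem_searchGraph_of_mem_graph hQ _) hPQ⟩

theorem replaceableIn_searchGraph_of_ne {i : Fin H.n}
    (ih : ∀ {u w P}, WalkConn T (H.graph (i + 1)) u w P →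
      ReplaceableIn T (H.searchGraph w) u w P)
    (hu : u ≠ H.order i) (hP : WalkConn T (H.graph i) u w P) :
    ReplaceableIn T (H.searchGraph w) u w P := by
  have hgraph : Sound T (H.graph i) := H.sound_graph i.2.le
  have hbypass {x Q} (hQ : WalkConn T (bypass T (H.graph i) (H.order i)) u x Q) :
      ReplaceableIn T (H.searchGraph x) u x Q := by
    obtain ⟨Q', hQ', hQr⟩ := (H.contracts i).replaceableIn_of_walkConn_bypass hgraph hQ
    exact (ih hQ').of_replaces hQr
  rcases hP.bypass_cases hu with ⟨-, hP⟩ | ⟨rfl, hloop⟩ | ⟨rfl, x, P₁, P₂, hx, hP₁, hP₂, hP₁₂, rfl⟩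
  · exact hbypass hP
  · exact (down_and_walkConn_of_loopConn hu hloop).2.replaceableIn
  · obtain ⟨hdown, hP₂'⟩ := down_and_walkConn_of_loopConn hx hP₂
    exact ((hbypass hP₁).mono (H.searchGraph_le_of_down hdown)).append (H.sound_searchGraph _)
      hP₂'.replaceableIn (hgraph.isJourney hP₂.walkConn) hP₁₂

theorem replaceableIn_searchGraph {i : ℕ} (hi : i ≤ H.n) (hP : WalkConn T (H.graph i) u w P) :
    ReplaceableIn T (H.searchGraph w) u w P := by
  induction hi using Nat.decreasingInduction generalizing u w P with
  | self => exact absurd (H.le_rank_of_walkConn le_rfl hP).1 (H.rank_lt u).not_ge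
  | of_succ i hi ih =>
    refine hP.head_induction_on (motive := fun u P => ReplaceableIn T (H.searchGraph w) u w P)
      (fun {u P} hP => ?_) fun {u x P Q} hP hQ hPQ ihQ => ?_
    all_goals by_cases hu : u = H.order ⟨i, hi⟩
    · subst hu
      exact (WalkConn.edge (mem_searchGraph_of_mem_graph hP w)).replaceableIn
    · exact replaceableIn_searchGraph_of_ne (i := ⟨i, hi⟩) ih hu (.edge hP)
    · subst hu
      exact (WalkConn.edge (mem_searchGraph_of_mem_graph hP w)).replaceableIn.append
        (H.sound_searchGraph w) ihQ ((H.sound_graph hi.le).isJourney hQ) hPQ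
    · exact replaceableIn_searchGraph_of_ne (i := ⟨i, hi⟩) ih hu ((WalkConn.edge hP).append hQ hPQ)

end Hierarchy

/-! ### The minimum operation -/

theorem exists_minimal_representatives {α : Type*} [Preorder α] {old s : Set α} (hold : old ⊆ s)
    (hs : s.Finite) :
    ∃ N ⊆ s, (∀ q ∈ s, ∃ p ∈ N, p ≤ q) ∧ (∀ p ∈ N, ∀ q ∈ N, p ≤ q → p = q) ∧
      ∀ q ∈ N, q ∉ old → ∀ p ∈ old, ¬ p ≤ q := by
  let M : Set α := {p | Minimal (· ∈ s) p ∧ (p ∉ old → ∀ r ∈ old, ¬ r ≤ p)}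
  obtain ⟨N, hNM, hbij⟩ := M.exists_subset_bijOn (toAntisymmetrization (α := α) (· ≤ ·))
  have hM_le : ∀ q ∈ s, ∃ p ∈ M, p ≤ q := by
    intro q hq
    obtain ⟨p, hpq, hp⟩ := hs.exists_le_minimal hq
    by_cases h : ∃ r ∈ old, r ≤ p
    · obtain ⟨r, hr, hrp⟩ := h
      have hr_min : Minimal (· ∈ s) r :=
        ⟨hold hr, fun _ ht htr => hrp.trans (hp.2 ht (htr.trans hrp))⟩
      exact ⟨r, ⟨hr_min, fun hr' => absurd hr hr'⟩, hrp.trans hpq⟩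
    · exact ⟨p, ⟨hp, fun _ r hr hrp => h ⟨r, hr, hrp⟩⟩, hpq⟩
  refine ⟨N, fun p hp => (hNM hp).1.1, fun q hq => ?_, fun p hp q hq hpq => ?_,
    fun q hq => (hNM hq).2⟩
  · obtain ⟨p, hp, hpq⟩ := hM_le q hq
    obtain ⟨p', hp', heq⟩ := hbij.surjOn (Set.mem_image_of_mem _ hp)
    have hp'p : AntisymmRel (· ≤ ·) p' p := Quotient.exact heq
    exact ⟨p', hp', hp'p.1.trans hpq⟩
  · have hqp : q ≤ p := (hNM hq).1.2 (hNM hp).1.1 hpq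
    exact hbij.injOn hp hq (Quotient.sound ⟨hpq, hqp⟩)

namespace Timetable

/-- Arrival connections at the station `S`, ordered by domination: the better, the smaller. -/
@[reducible] def arrivalPreorder (T : Timetable B Z) (S : B) : Preorder (Arrival Z) where
  le := T.DominatesArr S
  le_refl := .refl T S
  le_trans _ _ _ := .trans

theorem exists_isMinimum (T : Timetable B Z) (S : B) {old new : Set (Arrival Z)}
    (hfin : (old ∪ new).Finite) : ∃ N, T.IsMinimum S old new N :=
  let := T.arrivalPreorder S
  have ⟨N, hsub, hdominating, hdominant, hprefer⟩ :=
    exists_minimal_representatives (old := old) Set.subset_union_left hfin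
  ⟨N, hsub, hdominating, hdominant, hprefer⟩

theorem finite_setOf_runs (T : Timetable B Z) : {x | T.Runs x}.Finite := by
  have hfin : (⋃ c ∈ T.conns, (fun n => (c, 1440 * n + c.td)) '' (T.days c : Set ℤ)).Finite :=
    T.conns.finite_toSet.biUnion fun c _ => (T.days c).finite_toSet.image _
  refine hfin.subset ?_
  rintro ⟨c, d⟩ ⟨hc, hday, hd⟩
  have htd := T.td_mem c hc
  refine Set.mem_biUnion (x := c) hc ⟨d / 1440, hday, Prod.ext rfl ?_⟩
  have hmod : d % 1440 = c.td % 1440 := hd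
  dsimp only
  omega

/-- A finite set that contains the arrival connections that can occur in a search from time `t₀`
on, see `IsLabel.mem_labels`. -/
def labels (T : Timetable B Z) (t₀ : ℤ) : Set (Arrival Z) :=
  insert ⟨t₀, none⟩ ((fun x => (ride x).arrival) '' {x | T.Runs x})

theorem finite_labels (T : Timetable B Z) (t₀ : ℤ) : (T.labels t₀).Finite :=
  (T.finite_setOf_runs.image _).insert _

/-- The arrival connection `L` at the station `S` is justified in a search from `a` at time `t₀`:
it is the initial one, or the arrival of a journey that departs not before `t₀`. -/
def IsLabel (T : Timetable B Z) (a : B) (t₀ : ℤ) (S : B) (L : Arrival Z) : Prop :=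
  (S = a ∧ L = ⟨t₀, none⟩) ∨ ∃ P, T.IsJourney a S P ∧ t₀ ≤ P.dep ∧ L = P.arrival

namespace IsLabel

variable {a S S' : B} {t₀ : ℤ} {L : Arrival Z}

theorem mem_labels (hL : T.IsLabel a t₀ S L) : L ∈ T.labels t₀ := by
  rcases hL with ⟨-, rfl⟩ | ⟨P, hP, -, rfl⟩
  · exact Set.mem_insert _ _
  · obtain ⟨x, y, -, hy, rfl, -, -⟩ := hP.exists_runs
    exact Set.mem_insert_of_mem _ ⟨y, hy, rfl⟩

theorem reaches (hL : T.IsLabel a t₀ S L) : T.Reaches a S t₀ L.arr := by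
  rcases hL with ⟨hS, rfl⟩ | ⟨P, hP, hdep, rfl⟩
  · exact .inl ⟨hS, rfl⟩
  · exact reaches_iff_exists_isJourney.2 (.inr ⟨P, hP, hdep, rfl⟩)

theorem of_mem_linkArr {X : Set (Arrival Z)} {E : Set (Conn B Z)}
    (hX : ∀ M ∈ X, T.IsLabel a t₀ S M) (hE : ∀ P ∈ E, T.IsJourney S S' P)
    (hL : L ∈ T.linkArr S X E) : T.IsLabel a t₀ S' L := by
  obtain ⟨M, hM, Q, hQ, hboard, rfl⟩ := hL
  rcases hX M hM with ⟨rfl, rfl⟩ | ⟨P, hP, hdep, rfl⟩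
  · exact .inr ⟨Q, hE Q hQ, hboard, rfl⟩
  · have hPQ : T.CanLink P Q := ⟨hP.S2_eq.trans (hE Q hQ).S1_eq.symm, hP.S2_eq ▸ hboard⟩
    exact .inr ⟨P.link Q, hP.append (hE Q hQ) hPQ, hdep, rfl⟩

end IsLabel

end Timetable

/-! ### The invariant of the time query -/

/-- One of the arrival connections `X` at the station `S` dominates `L`. -/
def Timetable.IsDominated (T : Timetable B Z) (S : B) (X : Set (Arrival Z)) (L : Arrival Z) :
    Prop :=
  ∃ M ∈ X, T.DominatesArr S M L

theorem Timetable.IsMinimum.isDominated {S : B} {old new N : Set (Arrival Z)} {L : Arrival Z}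
    (hN : T.IsMinimum S old new N) (hL : T.IsDominated S old L) : T.IsDominated S N L := by
  obtain ⟨M, hM, hML⟩ := hL
  obtain ⟨M', hM', hM'M⟩ := hN.dominating M (.inl hM)
  exact ⟨M', hM', hM'M.trans hML⟩

namespace Hierarchy

variable {H : Hierarchy T} {a b : B} {t₀ : ℤ}

/-- The invariant of the forward search, where the edges in `pending` are yet to be relaxed. -/
structure SearchInv (H : Hierarchy T) (a b : B) (t₀ : ℤ) (pending : B → B → Prop)
    (corridor : Set B) (ac : B → Set (Arrival Z)) (Q : B → Option ℤ) : Prop where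
  mem_corridor : ∀ S, Relation.ReflTransGen H.Down S b → S ∈ corridor
  isLabel : ∀ S, ∀ L ∈ ac S, T.IsLabel a t₀ S L
  dominant : ∀ S, ∀ L ∈ ac S, ∀ M ∈ ac S, T.DominatesArr S L M → L = M
  start : T.IsDominated a (ac a) ⟨t₀, none⟩
  key : ∀ S k, Q S = some k → IsLeast (Arrival.arr '' ac S) k
  target : (ac b).Nonempty → Q b ≠ none
  settled : ∀ S S', Q S = none → H.SearchEdge corridor S S' → ¬ pending S S' →
    ∀ L ∈ T.linkArr S (ac S) (H.edge S S'), T.IsDominated S' (ac S') L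

namespace SearchInv

variable {corridor todo : Set B} {ac : B → Set (Arrival Z)} {Q : B → Option ℤ} {S S' : B}
  {N : Set (Arrival Z)} {L : Arrival Z}

section Correctness

variable (h : H.SearchInv a b t₀ (fun _ _ => False) corridor ac Q)
include h

theorem isDominated_arrival_of_mem (hP : P ∈ H.searchGraph b S S')
    (hL : T.IsDominated S (ac S) L) (hLP : T.CanBoard S L P)
    (hQ : ∀ k, Q S = some k → P.arr < k) : T.IsDominated S' (ac S') P.arrival := by
  obtain ⟨M, hM, hML⟩ := hL
  have hP_journey : T.IsJourney S S' P := H.sound_searchGraph b hP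
  have hMP : T.CanBoard S M P := hML.canBoard hP_journey hLP
  have hS : Q S = none := by
    refine Option.eq_none_iff_forall_ne_some.2 fun k hk => ?_
    have hkM : k ≤ M.arr := (h.key S k hk).2 ⟨M, hM, rfl⟩
    exact (hQ k hk).not_ge (hkM.trans (hMP.arr_le_dep.trans hP_journey.dep_le_arr))
  exact h.settled S S' hS ⟨⟨P, hP.1⟩, hP.2.imp_right (h.mem_corridor S')⟩ id _
    ⟨M, hM, P, hP.1, hMP, rfl⟩

theorem isDominated_arrival (hP : WalkConn T (H.searchGraph b) a x P) (hdep : t₀ ≤ P.dep)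
    (hQ : ∀ S k, Q S = some k → P.arr < k) : T.IsDominated x (ac x) P.arrival := by
  induction hP with
  | edge hP => exact h.isDominated_arrival_of_mem hP h.start hdep (hQ _)
  | @snoc x w P R hP hR hPR ih =>
    have hR_journey : T.IsJourney x w R := H.sound_searchGraph b hR
    have hPR_arr : P.arr ≤ R.arr := hPR.arr_le_dep.trans hR_journey.dep_le_arr
    have hP_dominated : T.IsDominated x (ac x) P.arrival :=
      ih hdep fun S k hk => hPR_arr.trans_lt (hQ S k hk)
    have hboard : T.CanBoard x P.arrival R :=
      ((H.sound_searchGraph b).isJourney hP).S2_eq ▸ hPR.2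
    exact h.isDominated_arrival_of_mem (P := R) hR hP_dominated hboard (hQ x)

theorem exists_arr_le {t : ℤ} (ht : T.Reaches a b t₀ t) (hQ : ∀ S k, Q S = some k → t < k) :
    ∃ L ∈ ac b, L.arr ≤ t := by
  rcases Timetable.reaches_iff_exists_isJourney.1 ht with ⟨rfl, rfl⟩ | ⟨P, hP, hdep, rfl⟩
  · obtain ⟨L, hL, hdom⟩ := h.start
    exact ⟨L, hL, hdom.1⟩
  · have hP₀ : WalkConn T (H.graph 0) a b P := H.graph_zero ▸ hP
    obtain ⟨P', hP', hr⟩ := replaceableIn_searchGraph (Nat.zero_le _) hP₀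
    obtain ⟨L, hL, hdom⟩ := h.isDominated_arrival hP' (hdep.trans hr.dep)
      fun S k hk => hr.arr.trans_lt (hQ S k hk)
    exact ⟨L, hL, hdom.1.trans hr.arr⟩

theorem solvesEAP_some {t : ℤ} (hb : Q b = some t) (hQ : ∀ S k, Q S = some k → t ≤ k) :
    T.SolvesEAP a b t₀ (some t) := by
  obtain ⟨⟨L, hL, rfl⟩, hleast⟩ := h.key b t hb
  refine ⟨(h.isLabel b L hL).reaches, fun t' ht' => not_lt.1 fun hlt => ?_⟩
  obtain ⟨L', hL', hle⟩ := h.exists_arr_le ht' fun S k hk => hlt.trans_le (hQ S k hk)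
  exact (hle.trans_lt hlt).not_ge (hleast ⟨L', hL', rfl⟩)

theorem solvesEAP_none (hQ : ∀ S, Q S = none) : T.SolvesEAP a b t₀ none := by
  intro t ht
  obtain ⟨L, hL, -⟩ := h.exists_arr_le ht fun S k hk => by simp [hQ S] at hk
  exact h.target ⟨L, hL⟩ (hQ b)

end Correctness

section Preservation

open Classical in
theorem initial (hcorridor : ∀ S, Relation.ReflTransGen H.Down S b → S ∈ corridor) :
    H.SearchInv a b t₀ (fun _ _ => False) corridor
      (Function.update (fun _ => ∅) a {⟨t₀, none⟩})
      (Function.update (fun _ => none) a (some t₀)) where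
  mem_corridor := hcorridor
  isLabel := by
    rw [Function.forall_update_iff _ fun S X => ∀ L ∈ X, T.IsLabel a t₀ S L]
    exact ⟨fun L hL => .inl ⟨rfl, hL⟩, fun _ _ _ hL => hL.elim⟩
  dominant := by
    rw [Function.forall_update_iff _ fun S X => ∀ L ∈ X, ∀ M ∈ X, T.DominatesArr S L M → L = M]
    exact ⟨fun L hL M hM _ => hL.trans hM.symm, fun _ _ _ hL => hL.elim⟩
  start := ⟨_, by rw [Function.update_self]; rfl, .refl T a _⟩
  key S k hk := by
    by_cases hS : S = a
    · subst hS
      obtain rfl : t₀ = k := by simpa using hk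
      simp
    · simp [hS] at hk
  target := by
    by_cases hb : b = a <;> simp [hb]
  settled S S' hS _ _ := by
    by_cases hSa : S = a
    · simp [hSa] at hS
    · simp [hSa, Timetable.linkArr]

open Classical in
theorem deleteMin (h : H.SearchInv a b t₀ (fun _ _ => False) corridor ac Q) (hS : S ≠ b) :
    H.SearchInv a b t₀ (fun x y => x = S ∧ y ∈ {S' | H.SearchEdge corridor S S'}) corridor ac
      (Function.update Q S none) where
  __ := h
  key x k hk := by
    by_cases hx : x = S
    · simp [hx] at hk
    · exact h.key x k (by simpa [hx] using hk)
  target hb := by simpa [hS.symm] using h.target hb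
  settled x y hx hxy hp := by
    have hxS : x ≠ S := fun hxS => hp ⟨hxS, hxS ▸ hxy⟩
    exact h.settled x y (by simpa [hxS] using hx) hxy id

theorem next (h : H.SearchInv a b t₀ (fun x y => x = S ∧ y ∈ (∅ : Set B)) corridor ac Q) :
    H.SearchInv a b t₀ (fun _ _ => False) corridor ac Q where
  __ := h
  settled x y hx hxy _ := h.settled x y hx hxy And.right

open Classical in
theorem isDominated_update
    (hN : T.IsMinimum S' (ac S') (T.linkArr S (ac S) (H.edge S S')) N)
    (hL : T.IsDominated x (ac x) L) : T.IsDominated x (Function.update ac S' N x) L := by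
  by_cases hx : x = S'
  · subst hx
    exact (Function.update_self x N ac).symm ▸ hN.isDominated hL
  · rwa [Function.update_of_ne hx]

variable (h : H.SearchInv a b t₀ (fun x y => x = S ∧ y ∈ todo) corridor ac Q)
include h

theorem isLabel_of_isMinimum
    (hN : T.IsMinimum S' (ac S') (T.linkArr S (ac S) (H.edge S S')) N) (hL : L ∈ N) :
    T.IsLabel a t₀ S' L := by
  rcases hN.sub hL with hL | hL
  · exact h.isLabel S' L hL
  · exact .of_mem_linkArr (h.isLabel S) (fun P hP => H.sound_edge hP) hL

open Classical in
theorem settled_update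
    (hN : T.IsMinimum S' (ac S') (T.linkArr S (ac S) (H.edge S S')) N) (x y : B)
    (hx : Q x = none) (hxy : H.SearchEdge corridor x y) (hp : ¬ (x = S ∧ y ∈ todo \ {S'})) :
    ∀ L ∈ T.linkArr x (ac x) (H.edge x y), T.IsDominated y (Function.update ac S' N y) L := by
  intro L hL
  by_cases hp' : x = S ∧ y ∈ todo
  · obtain ⟨rfl, hy⟩ := hp'
    obtain rfl : y = S' := by_contra fun hyS' => hp ⟨rfl, hy, hyS'⟩
    rw [Function.update_self]
    exact hN.dominating L (.inr hL)
  · exact isDominated_update hN (h.settled x y hx hxy hp' L hL)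

theorem keep (hN : T.IsMinimum S' (ac S') (T.linkArr S (ac S) (H.edge S S')) (ac S')) :
    H.SearchInv a b t₀ (fun x y => x = S ∧ y ∈ todo \ {S'}) corridor ac Q where
  __ := h
  settled := by
    classical simpa only [Function.update_eq_self] using h.settled_update hN

open Classical in
theorem improve {k : ℤ}
    (hN : T.IsMinimum S' (ac S') (T.linkArr S (ac S) (H.edge S S')) N)
    (hk : IsLeast (Arrival.arr '' N) k) :
    H.SearchInv a b t₀ (fun x y => x = S ∧ y ∈ todo \ {S'}) corridor
      (Function.update ac S' N) (Function.update Q S' (some k)) where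
  mem_corridor := h.mem_corridor
  isLabel := by
    rw [Function.forall_update_iff _ fun S X => ∀ L ∈ X, T.IsLabel a t₀ S L]
    exact ⟨fun L => h.isLabel_of_isMinimum hN, fun x _ => h.isLabel x⟩
  dominant := by
    rw [Function.forall_update_iff _ fun S X => ∀ L ∈ X, ∀ M ∈ X, T.DominatesArr S L M → L = M]
    exact ⟨hN.dominant, fun x _ => h.dominant x⟩
  start := isDominated_update hN h.start
  key x l hl := by
    by_cases hx : x = S'
    · subst hx
      obtain rfl : k = l := by simpa using hl
      simpa using hk
    · simpa [hx] using h.key x l (by simpa [hx] using hl)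
  target := by
    by_cases hb : b = S'
    · simp [hb]
    · simpa [hb] using h.target
  settled x y hx hxy hp := by
    have hxS' : x ≠ S' := by
      rintro rfl
      simp at hx
    rw [Function.update_of_ne hxS'] at hx ⊢
    exact h.settled_update hN x y hx hxy hp

end Preservation

end SearchInv

/-- The invariant of the time query. -/
def Inv (H : Hierarchy T) (a b : B) (t₀ : ℤ) : Config B Z → Prop
  | .backward queue visited =>
    b ∈ visited ∧ ∀ S' ∈ visited, S' ∉ queue → ∀ S, H.Down S S' → S ∈ visited
  | .forward corridor ac Q => H.SearchInv a b t₀ (fun _ _ => False) corridor ac Q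
  | .relaxing corridor S todo ac Q =>
    H.SearchInv a b t₀ (fun x y => x = S ∧ y ∈ todo) corridor ac Q
  | .done r => T.SolvesEAP a b t₀ r

namespace Inv

theorem initial (H : Hierarchy T) (a b : B) (t₀ : ℤ) : H.Inv a b t₀ (H.initial b) :=
  ⟨rfl, fun _ hS' hqueue => absurd (List.mem_singleton.2 hS') hqueue⟩

theorem visit {S' : B} {queue new : List B} {visited : Set B}
    (h : H.Inv a b t₀ (.backward (S' :: queue) visited))
    (hnew : ∀ S, S ∈ new ↔ S ∉ visited ∧ (H.edge S S').Nonempty ∧ H.rank S' < H.rank S) :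
    H.Inv a b t₀ (.backward (queue ++ new) (visited ∪ {S | S ∈ new})) := by
  refine ⟨.inl h.1, fun S hS hqueue S₁ hdown => or_iff_not_imp_left.2 fun hS₁ => ?_⟩
  obtain ⟨hS_queue, hS_new⟩ := not_or.1 (mt List.mem_append.2 hqueue)
  have hS : S ∈ visited := hS.resolve_right hS_new
  by_cases hSS' : S = S'
  · subst hSS'
    exact (hnew S₁).2 ⟨hS₁, hdown⟩
  · exact absurd (h.2 S hS (by simp [hSS', hS_queue]) S₁ hdown) hS₁

theorem mem_visited {visited : Set B} (h : H.Inv a b t₀ (.backward [] visited)) {S : B}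
    (hS : Relation.ReflTransGen H.Down S b) : S ∈ visited := by
  induction hS using Relation.ReflTransGen.head_induction_on with
  | refl => exact h.1
  | head hdown _ ih => exact h.2 _ ih List.not_mem_nil _ hdown

theorem step {x y : Config B Z} (hx : H.Inv a b t₀ x) (hxy : H.Step a b t₀ x y) :
    H.Inv a b t₀ y := by
  cases hxy with
  | visit _ hnew => exact hx.visit hnew
  | start => exact SearchInv.initial fun _ => hx.mem_visited
  | found hb hmin => exact SearchInv.solvesEAP_some hx hb hmin
  | deleteMin hS _ _ => exact SearchInv.deleteMin hx hS
  | keep _ hN => exact SearchInv.keep hx hN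
  | improve _ hN _ hk => exact SearchInv.improve hx hN hk
  | next => exact SearchInv.next hx
  | exhausted hQ => exact SearchInv.solvesEAP_none hx hQ

end Inv

/-! ### Progress and termination -/

theorem finite_stations (H : Hierarchy T) : Finite B := Finite.of_equiv _ H.order

theorem exists_step_backward (H : Hierarchy T) (a b : B) (t₀ : ℤ) (queue : List B)
    (visited : Set B) : ∃ y, H.Step a b t₀ (.backward queue visited) y := by
  have := H.finite_stations
  cases queue with
  | nil => exact ⟨_, .start⟩
  | cons S' queue =>
    have hnew := Set.toFinite {S | S ∉ visited ∧ H.Down S S'}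
    exact ⟨_, .visit (new := hnew.toFinset.toList) (Finset.nodup_toList _) (by simp [Down])⟩

theorem exists_minimal_key [Finite B] {Q : B → Option ℤ} (hQ : ∃ S, Q S ≠ none) :
    ∃ S t, Q S = some t ∧ ∀ S' t', Q S' = some t' → t ≤ t' := by
  obtain ⟨S, hS, hmin⟩ := Set.exists_min_image {S | Q S ≠ none} (fun S => (Q S).getD 0)
    (Set.toFinite _) hQ
  obtain ⟨t, ht⟩ := Option.ne_none_iff_exists'.1 hS
  exact ⟨S, t, ht, fun S' t' ht' => by simpa [ht, ht'] using hmin S' (by simp [ht'])⟩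

theorem exists_step_forward (H : Hierarchy T) (a b : B) (t₀ : ℤ) (corridor : Set B)
    (ac : B → Set (Arrival Z)) (Q : B → Option ℤ) :
    ∃ y, H.Step a b t₀ (.forward corridor ac Q) y := by
  have := H.finite_stations
  by_cases hQ : ∃ S, Q S ≠ none
  · obtain ⟨S, t, ht, hmin⟩ := exists_minimal_key hQ
    by_cases hS : S = b
    · exact ⟨_, .found (hS ▸ ht) hmin⟩
    · exact ⟨_, .deleteMin hS ht hmin⟩
  · exact ⟨_, .exhausted (by simpa using hQ)⟩

theorem SearchInv.exists_step {corridor todo : Set B} {ac : B → Set (Arrival Z)}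
    {Q : B → Option ℤ} {S : B}
    (h : H.SearchInv a b t₀ (fun x y => x = S ∧ y ∈ todo) corridor ac Q) :
    ∃ y, H.Step a b t₀ (.relaxing corridor S todo ac Q) y := by
  rcases todo.eq_empty_or_nonempty with rfl | ⟨S', hS'⟩
  · exact ⟨_, .next⟩
  have hfin : (ac S' ∪ T.linkArr S (ac S) (H.edge S S')).Finite := by
    refine (T.finite_labels t₀).subset (Set.union_subset (fun L hL => ?_) fun L hL => ?_)
    · exact (h.isLabel S' L hL).mem_labels
    · exact (Timetable.IsLabel.of_mem_linkArr (h.isLabel S) (fun P hP => H.sound_edge hP)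
        hL).mem_labels
  obtain ⟨N, hN⟩ := T.exists_isMinimum S' hfin
  by_cases hne : N = ac S'
  · exact ⟨_, .keep hS' (hne ▸ hN)⟩
  have hN_nonempty : N.Nonempty := by
    contrapose! hne
    subst hne
    refine (Set.eq_empty_of_forall_notMem fun L hL => ?_).symm
    obtain ⟨M, hM, -⟩ := hN.dominating L (.inl hL)
    exact hM
  obtain ⟨L, hL, hmin⟩ :=
    Set.exists_min_image N Arrival.arr (hfin.subset hN.sub) hN_nonempty
  exact ⟨_, .improve (k := L.arr) hS' hN hne ⟨⟨L, hL, rfl⟩, Set.forall_mem_image.2 hmin⟩⟩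

theorem Inv.eq_done_of_not_exists_step {x : Config B Z} (hx : H.Inv a b t₀ x)
    (hstuck : ¬ ∃ y, H.Step a b t₀ x y) : ∃ r, x = .done r := by
  cases x with
  | backward queue visited => exact absurd (H.exists_step_backward a b t₀ queue visited) hstuck
  | forward corridor ac Q => exact absurd (H.exists_step_forward a b t₀ corridor ac Q) hstuck
  | relaxing => exact absurd (SearchInv.exists_step hx) hstuck
  | done r => exact ⟨r, rfl⟩

/-- The labels that are not yet dominated at the station with which they are paired. They measure
how far the forward search is from its end. -/
def undominated (T : Timetable B Z) (t₀ : ℤ) (ac : B → Set (Arrival Z)) : Set (B × Arrival Z) :=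
  {x | x.2 ∈ T.labels t₀ ∧ ¬ T.IsDominated x.1 (ac x.1) x.2}

theorem finite_undominated [Finite B] (ac : B → Set (Arrival Z)) :
    (undominated T t₀ ac).Finite :=
  (Set.finite_univ.prod (T.finite_labels t₀)).subset fun _ hx => ⟨trivial, hx.1⟩

open Classical in
theorem SearchInv.undominated_ssubset {corridor todo : Set B} {ac : B → Set (Arrival Z)}
    {Q : B → Option ℤ} {S S' : B} {N : Set (Arrival Z)}
    (h : H.SearchInv a b t₀ (fun x y => x = S ∧ y ∈ todo) corridor ac Q)
    (hN : T.IsMinimum S' (ac S') (T.linkArr S (ac S) (H.edge S S')) N) (hne : N ≠ ac S') :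
    undominated T t₀ (Function.update ac S' N) ⊂ undominated T t₀ ac := by
  refine ⟨fun x hx => ⟨hx.1, mt (isDominated_update hN) hx.2⟩, fun hsub => hne ?_⟩
  have hN_sub : N ⊆ ac S' := by
    refine fun L hL => by_contra fun hL_old => ?_
    have hL_undominated : (S', L) ∈ undominated T t₀ ac :=
      ⟨(h.isLabel_of_isMinimum hN hL).mem_labels,
        fun ⟨M, hM, hML⟩ => hN.prefer_old L hL hL_old M hM hML⟩
    exact (hsub hL_undominated).2 ⟨L, by rwa [Function.update_self], .refl T S' L⟩
  refine hN_sub.antisymm fun L hL => ?_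
  obtain ⟨M, hM, hML⟩ := hN.dominating L (.inl hL)
  exact h.dominant S' M (hN_sub hM) L hL hML ▸ hM

/-- A measure of what is left to do, which decreases lexicographically in each step of the time
query. Its first component is the phase, and the others are sizes: of the unvisited part of the
graph and the queue in the backward search, of the undominated labels, the queue and the edges to be
relaxed in the forward search. -/
noncomputable def remaining (T : Timetable B Z) (t₀ : ℤ) : Config B Z → ℕ ×ₗ ℕ ×ₗ ℕ ×ₗ ℕ
  | .backward queue visited => toLex (2, toLex (visitedᶜ.ncard, toLex (queue.length, 0)))
  | .forward _ ac Q =>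
    toLex (1, toLex ((undominated T t₀ ac).ncard, toLex ({S | Q S ≠ none}.ncard, 0)))
  | .relaxing _ _ todo ac Q =>
    toLex (1, toLex ((undominated T t₀ ac).ncard,
      toLex ({S | Q S ≠ none}.ncard, todo.ncard + 1)))
  | .done _ => toLex (0, toLex (0, toLex (0, 0)))

theorem remaining_visit_lt [Finite B] {S' : B} {queue new : List B} {visited : Set B}
    (hnew : ∀ S ∈ new, S ∉ visited) :
    remaining T t₀ (.backward (queue ++ new) (visited ∪ {S | S ∈ new})) <
      remaining T t₀ (.backward (S' :: queue) visited) := by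
  rcases new with _ | ⟨S, new⟩
  · simp [remaining, Prod.Lex.toLex_lt_toLex]
  · have hS : S ∉ visited := hnew S List.mem_cons_self
    have hlt : (visited ∪ {x | x ∈ S :: new})ᶜ.ncard < visitedᶜ.ncard := by
      refine Set.ncard_lt_ncard ⟨Set.compl_subset_compl.2 Set.subset_union_left, fun hsub => ?_⟩
      exact hsub hS (.inr List.mem_cons_self)
    simp only [remaining, Prod.Lex.toLex_lt_toLex, hlt, true_or, and_self, or_true]

theorem ncard_support_update_none_lt {α β : Type*} [Finite α] [DecidableEq α] {f : α → Option β}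
    {i : α} (hi : f i ≠ none) :
    {j | Function.update f i none j ≠ none}.ncard < {j | f j ≠ none}.ncard := by
  have heq : {j | Function.update f i none j ≠ none} = {j | f j ≠ none} \ {i} := by
    ext j
    by_cases hj : j = i <;> simp [hj]
  exact heq ▸ Set.ncard_sdiff_singleton_lt_of_mem hi

open Classical in
theorem Inv.remaining_lt {x y : Config B Z} (hx : H.Inv a b t₀ x) (hxy : H.Step a b t₀ x y) :
    remaining T t₀ y < remaining T t₀ x := by
  have := H.finite_stations
  cases hxy with
  | visit _ hnew => exact remaining_visit_lt fun S hS => ((hnew S).1 hS).1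
  | deleteMin _ hS _ =>
    have hlt := ncard_support_update_none_lt (Option.ne_none_iff_exists'.2 ⟨_, hS⟩)
    simpa [remaining, Prod.Lex.toLex_lt_toLex] using hlt
  | @keep _ todo _ _ _ S' hS' _ =>
    have hlt : (todo \ {S'}).ncard < todo.ncard := Set.ncard_sdiff_singleton_lt_of_mem hS'
    simp [remaining, Prod.Lex.toLex_lt_toLex, hlt]
  | improve _ hN hne _ =>
    have hlt := Set.ncard_lt_ncard (SearchInv.undominated_ssubset hx hN hne)
      (finite_undominated _)
    simp [remaining, Prod.Lex.toLex_lt_toLex, hlt]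
  | start | found | next | exhausted => simp [remaining, Prod.Lex.toLex_lt_toLex]

namespace Inv

theorem acc {x : Config B Z} (hx : H.Inv a b t₀ x) : Acc (fun y x => H.Step a b t₀ x y) x := by
  induction hm : remaining T t₀ x using WellFoundedLT.induction generalizing x with
  | ind m ih =>
    subst hm
    exact ⟨_, fun y hxy => ih _ (hx.remaining_lt hxy) (hx.step hxy) rfl⟩

theorem of_reflTransGen {x y : Config B Z} (hx : H.Inv a b t₀ x)
    (hxy : Relation.ReflTransGen (H.Step a b t₀) x y) : H.Inv a b t₀ y := by
  induction hxy with
  | refl => exact hx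
  | tail _ hyz ih => exact ih.step hyz

end Inv

end Hierarchy

end StationGraph

/-- The time query in a station graph contraction hierarchy solves the earliest arrival problem:
every execution terminates, and one that cannot be continued has returned a solution. -/
theorem mainTheorem2 {B Z : Type*} (T : StationGraph.Timetable B Z)
    (H : StationGraph.Hierarchy T) (a b : B) (t₀ : ℤ) :
    Acc (fun y x => H.Step a b t₀ x y) (H.initial b) ∧
    ∀ x, Relation.ReflTransGen (H.Step a b t₀) (H.initial b) x →
      (¬ ∃ y, H.Step a b t₀ x y) →
      ∃ r, x = StationGraph.Config.done r ∧ T.SolvesEAP a b t₀ r := by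
  have hinitial : H.Inv a b t₀ (H.initial b) := .initial H a b t₀
  refine ⟨hinitial.acc, fun x hx hstuck => ?_⟩
  have hinv : H.Inv a b t₀ x := hinitial.of_reflTransGen hx
  obtain ⟨r, rfl⟩ := hinv.eq_done_of_not_exists_step hstuck
  exact ⟨r, rfl, hinv⟩
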